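/- \textbf{Setting.} Consider $n$ pursuers in the plane and a stationary target $T$. Pursuer $i$ has position $P_i=(x_i,y_i)$, heading $\gamma_i$, constant speed $V_i>0$ and lateral acceleration $a_i$, with $$\dot x_i=V_i\cos\gamma_i,\qquad \dot y_i=V_i\sin\gamma_i,\qquad \dot\gamma_i=a_i/V_i .$$ Let $R_i=|T-P_i|$, let $\theta_i\in(-\pi,\pi]$ be the signed angle from the heading of pursuer $i$ to its line of sight to $T$, and assume $\theta_i(0)\notin\{0,\pi\}$. Put $$\tilde t_i=\frac{R_i\theta_i}{V_i\sin\theta_i},\qquad a_i'=\frac{2V_i^2\sin\theta_i}{R_i}.$$ The pursuers communicate over a switching digraph $\mathcal G(t)$ on the fixed node set $\mathcal V=\{1,\dots,n\}$: it is right-continuous in $t$, piecewise constant, and switches finitely often on every bounded time interval. Up to the first interception, for almost every $t$, they follow the guidance law $$a_i=0\ \text{ if } \tilde t_i<\tilde t_j \text{ for some out-neighbour } j \text{ of } i,\qquad a_i=a_i'\ \text{ otherwise},$$ where the only relaxation is that $a_i$ may be any value between $0$ and $a_i'$ (an average over chattering between the two commands) when no out-neighbour of $i$ has a larger $\tilde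 t$ but a path in $\mathcal G(t)$ along nodes all having the same $\tilde t$ as $i$ leads from $i$ to a node which has an out-neighbour with strictly larger $\tilde t$. A leader at time $t$ is a pursuer with the largest $\tilde t_i(t)$; a node is globally reachable if every node has a directed path to it. \textbf{Theorem.} Let $t_1<t_2<\cdots$ (finitely many, infinitely many or none, $t_1\ge 0$) be the times at which the leader loses global reachability, and let $\delta_m>0$, $t_m+\delta_m<t_{m+1}$, be the durations of these losses: up to the first interception, at every time outside $\bigcup_m[t_m,t_m+\delta_m)$ a leader is globally reachable in $\mathcal G(t)$. If $$\delta_m<\min_{i\in\mathcal V}\tilde t_i(t_m)$$ for every $m$ such that no pursuer has reached the target up to time $t_m$, then the system achieves consensus in the $\tilde t_i$ and the pursuers intercept the target simultaneously. Precisely, with $t_f=\max_i\tilde t_i(0)>0$: there is $t_\alpha\in[0,t_f)$ such that $\tilde t_i(t)=\tilde t_j(t)$ for all $i,j\in\mathcal V$ and all $t\in[t_\alpha,t_f)$; no pursuer is at $T$ at any time $t\in[0,t_f)$; and $P_i(t_f)=T$ for every $i\in\mathcal V$. -/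

import Mathlib

open Set Filter Topology MeasureTheory

noncomputable section

namespace Pursuit

/-- The pose of a planar unicycle. The plane `ℝ²` is identified with `ℂ`, so the position
`(x, y)` is `x + y i`; the heading is the angle of the velocity with the X-axis. -/
structure Pose where
  pos : ℂ
  heading : ℝ

/-- The distance `R` between the pursuer and the target. -/
def targetDist (T : ℂ) (p : Pose) : ℝ := ‖T - p.pos‖

/-- The lead angle `θ ∈ (-π, π]`: the signed angle from the heading direction to the line of
sight from the pursuer to the target. -/
def leadAngle (T : ℂ) (p : Pose) : ℝ :=
  Complex.arg ((T - p.pos) * Complex.exp (-(p.heading * Complex.I)))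

/-- The estimated time of interception `R θ / (V sin θ)`: the time needed at speed `V` to reach
the target along the circular arc determined by the pose. -/
def estTime (V : ℝ) (T : ℂ) (p : Pose) : ℝ :=
  targetDist T p * leadAngle T p / (V * Real.sin (leadAngle T p))

/-- The lateral acceleration `2 V² sin θ / R` of the circular path to the target. -/
def circAccel (V : ℝ) (T : ℂ) (p : Pose) : ℝ :=
  2 * V ^ 2 * Real.sin (leadAngle T p) / targetDist T p

/-- A node is globally reachable if there is a directed path to it from every node. -/
def GloballyReachable {n : ℕ} (G : Digraph (Fin n)) (i : Fin n) : Prop :=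
  ∀ j, Relation.ReflTransGen G.Adj j i

/-- A switching digraph on a fixed node set: at every time it stays static for some time
afterwards and has been static for some time before, so that on bounded time intervals it
switches finitely often. -/
structure IsSwitchingDigraph {n : ℕ} (G : ℝ → Digraph (Fin n)) : Prop where
  right : ∀ t, 0 ≤ t → ∀ᶠ s in 𝓝[≥] t, G s = G t
  left : ∀ t, 0 < t → ∃ H, ∀ᶠ s in 𝓝[<] t, G s = H

/-- A pursuer is a leader if its estimated time of interception is the largest. -/
def IsLeader {n : ℕ} (V : Fin n → ℝ) (T : ℂ) (p : Fin n → Pose) (i : Fin n) : Prop :=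
  ∀ j, estTime (V j) T (p j) ≤ estTime (V i) T (p i)

/-- Some leader (there may be ties) is globally reachable. -/
def LeaderReachable {n : ℕ} (V : Fin n → ℝ) (T : ℂ) (G : Digraph (Fin n))
    (p : Fin n → Pose) : Prop :=
  ∃ i, IsLeader V T p i ∧ GloballyReachable G i

/-- With estimated times `τ`, pursuer `i` hangs, through a (possibly trivial) chain of
out-neighbours tied with it, on a pursuer that has an out-neighbour with a strictly larger
estimated time, hence moves straight. In this situation a tied pursuer that turned onto its circle
would fall behind at once and return to a straight line, and so on: it chatters. -/
def TiedToStraight {n : ℕ} (G : Digraph (Fin n)) (τ : Fin n → ℝ) (i : Fin n) : Prop :=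
  ∃ q, Relation.ReflTransGen (fun u v => G.Adj u v ∧ τ v = τ u) i q ∧
    ∃ j, G.Adj q j ∧ τ q < τ j

/-- The guidance law for pursuer `i` with lateral acceleration `a`: go straight if some
out-neighbour has a larger estimated time, and otherwise take the circular path. The only
relaxation is that a pursuer that ties with its out-neighbours and chatters (see
`TiedToStraight`) may use an average of the two commands, as for a sliding motion. -/
def GuidanceLaw {n : ℕ} (V : Fin n → ℝ) (T : ℂ) (G : Digraph (Fin n)) (p : Fin n → Pose)
    (i : Fin n) (a : ℝ) : Prop :=
  ((∃ j, G.Adj i j ∧ estTime (V i) T (p i) < estTime (V j) T (p j)) → a = 0) ∧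
  ((∀ j, G.Adj i j → estTime (V j) T (p j) ≤ estTime (V i) T (p i)) →
    a = circAccel (V i) T (p i) ∨
    (TiedToStraight G (fun j => estTime (V j) T (p j)) i ∧
      a ∈ segment ℝ 0 (circAccel (V i) T (p i))))

/-- No pursuer has reached the target up to and including time `t`. -/
def Engaged {n : ℕ} (T : ℂ) (x : ℝ → Fin n → Pose) (t : ℝ) : Prop :=
  0 ≤ t ∧ ∀ s ∈ Icc 0 t, ∀ i, (x s i).pos ≠ T

/-- The motions `x` with lateral accelerations `a` are a solution of the unicycle kinematics
`ẋ = V cos γ`, `ẏ = V sin γ`, `γ̇ = a / V` (in the sense of Carathéodory: `γ` is an integral)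
under the guidance law over the switching digraph `G`, until the first interception. Nothing but
continuity of the positions is required afterwards. -/
structure IsGuidedMotion {n : ℕ} (V : Fin n → ℝ) (T : ℂ) (G : ℝ → Digraph (Fin n))
    (x : ℝ → Fin n → Pose) (a : ℝ → Fin n → ℝ) : Prop where
  pos_continuous : ∀ i, ContinuousOn (fun t => (x t i).pos) (Ici 0)
  pos_deriv : ∀ i t, Engaged T x t → HasDerivWithinAt (fun s => (x s i).pos)
    ((V i * Real.cos (x t i).heading : ℝ) + (V i * Real.sin (x t i).heading : ℝ) * Complex.I)
    (Ici 0) t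
  accel_integrable : ∀ i t, Engaged T x t → IntervalIntegrable (fun s => a s i) volume 0 t
  heading_eq : ∀ i t, Engaged T x t →
    (x t i).heading = (x 0 i).heading + ∫ s in (0 : ℝ)..t, a s i / V i
  law : ∀ i, ∀ᵐ t, Engaged T x t → GuidanceLaw V T (G t) (x t) i (a t i)

end Pursuit

end

/-! Study `z_i(s) = estTime_i(s) + s`, the predicted instant of arrival. If the acceleration is `u`
times the circular command, then almost everywhere `z_i' = 2(1 - u)(1 - θ cot θ)`. The law forces `0
≤ u ≤ 1`, so every `z_i` is nondecreasing (`estTime_add_le`). A leader has `u = 1`, so `max_i z_i`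
is constant, equal to `tf` (`estTime_add_le_of_isLeader`). Hence a first interception occurs at some
`tc ≤ tf`, and a pursuer `i₀` arriving then has `z_{i₀} ≤ tc` beforehand
(`estTime_add_le_of_interception`).

A loss of reachability cannot last until `tc`: its duration is less than the estimated time of `i₀`
at its start, which is at most the time left to `tc`. So a leader is reachable at times arbitrarily
close to `tc` (`exists_leaderReachable`).

Suppose some pursuer never attains `z = tf` before `tc`. Close to `tc` the digraph is constant, and
the sets of pursuers that have attained `tf` or exceeded `tc` no longer change. Among the pursuers
that attain neither, a path to the leader gives one with an out-neighbour permanently ahead of it.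
It moves straight until `tc`, so its offset from the target across its heading is a nonzero
constant, while `R ≤ V · estTime ≤ V (tc - s)` tends to `0`: a contradiction (`not_ae_straight`).
Thus all `z_i` equal `tf` near `tc`, whence `tc = tf`, and the same bound on `R` brings everyone to
the target. -/

/-! ### Calculus for Lipschitz and absolutely continuous functions -/

theorem LipschitzOnWith.exists_comp_of_contDiffAt {E F : Type*} [NormedAddCommGroup E]
    [NormedSpace ℝ E] [NormedAddCommGroup F] [NormedSpace ℝ F] {q : ℝ → E} {f : E → F} {K : NNReal}
    {a b : ℝ} (hq : LipschitzOnWith K q (Icc a b)) (hf : ∀ t ∈ Icc a b, ContDiffAt ℝ 1 f (q t)) :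
    ∃ K', LipschitzOnWith K' (fun t => f (q t)) (Icc a b) := by
  refine LocallyLipschitzOn.exists_lipschitzOnWith_of_compact isCompact_Icc fun t ht => ?_
  obtain ⟨C, u, hu, hC⟩ := (hf t ht).exists_lipschitzOnWith
  have hu' : q ⁻¹' u ∈ 𝓝[Icc a b] t := (hq.continuousOn t ht).preimage_mem_nhdsWithin hu
  refine ⟨C * K, q ⁻¹' u ∩ Icc a b, inter_mem hu' self_mem_nhdsWithin, ?_⟩
  exact hC.comp (hq.mono inter_subset_right) fun s hs => hs.1

/-- Accelerations are only integrable, so derivatives exist only almost everywhere; absolute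
continuity makes the increment the integral of the derivative. -/
theorem AbsolutelyContinuousOnInterval.le_of_ae_hasDerivAt_nonneg {f : ℝ → ℝ} {a b : ℝ}
    (hab : a ≤ b) (hf : AbsolutelyContinuousOnInterval f a b)
    (hd : ∀ᵐ t, t ∈ Ioo a b → ∃ d, 0 ≤ d ∧ HasDerivAt f d t) : f a ≤ f b := by
  rw [← sub_nonneg, ← hf.integral_deriv_eq_sub]
  refine intervalIntegral.integral_nonneg_of_ae_restrict hab ?_
  rw [EventuallyLE, ← restrict_Ioo_eq_restrict_Icc, ae_restrict_iff' measurableSet_Ioo]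
  filter_upwards [hd] with t ht hmem
  obtain ⟨d, hd, h⟩ := ht hmem
  simpa [h.deriv] using hd

theorem AbsolutelyContinuousOnInterval.eq_of_ae_hasDerivAt_zero {f : ℝ → ℝ} {a b : ℝ}
    (hab : a ≤ b) (hf : AbsolutelyContinuousOnInterval f a b)
    (hd : ∀ᵐ t, t ∈ Ioo a b → HasDerivAt f 0 t) : f a = f b := by
  apply le_antisymm
  · exact hf.le_of_ae_hasDerivAt_nonneg hab (hd.mono fun t h ht => ⟨0, le_rfl, h ht⟩)
  · refine neg_le_neg_iff.1 (AbsolutelyContinuousOnInterval.le_of_ae_hasDerivAt_nonneg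
      (f := fun t => -f t) hab hf.neg ?_)
    exact hd.mono fun t h ht => ⟨0, le_rfl, by simpa using (h ht).fun_neg⟩

theorem Real.mul_cos_le_sin {x : ℝ} (h0 : 0 ≤ x) (hpi : x ≤ Real.pi) : x * Real.cos x ≤ Real.sin x := by
  rcases le_or_gt (Real.pi / 2) x with h | h
  · have h1 : Real.cos x ≤ 0 := Real.cos_nonpos_of_pi_div_two_le_of_le h (by linarith [Real.pi_pos])
    have h2 := Real.sin_nonneg_of_nonneg_of_le_pi h0 hpi
    nlinarith
  · have hc : 0 < Real.cos x := Real.cos_pos_of_mem_Ioo ⟨by linarith [Real.pi_pos], h⟩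
    have := Real.le_tan h0 h
    rwa [Real.tan_eq_sin_div_cos, le_div_iff₀ hc] at this

theorem Complex.contDiffAt_arg {z : ℂ} (hz : z ∈ Complex.slitPlane) {n : WithTop ℕ∞} :
    ContDiffAt ℝ n Complex.arg z := by
  have h : ContDiffAt ℝ n Complex.log z := (Complex.contDiffAt_log hz).restrict_scalars ℝ
  exact (Complex.imCLM.contDiff.contDiffAt.comp z h).congr_of_eventuallyEq
    (Eventually.of_forall fun w => by simp [Complex.log_im])

theorem HasDerivAt.carg {f : ℝ → ℂ} {f' : ℂ} {t : ℝ} (h : HasDerivAt f f' t)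
    (hz : f t ∈ Complex.slitPlane) : HasDerivAt (fun s => (f s).arg) (f' / f t).im t := by
  have h1 := Complex.imCLM.hasFDerivAt.comp_hasDerivAt t (h.clog_real hz)
  exact h1.congr_of_eventuallyEq (Eventually.of_forall fun w => by simp [Complex.log_im])

theorem HasDerivAt.cre {f : ℝ → ℂ} {f' : ℂ} {t : ℝ} (h : HasDerivAt f f' t) :
    HasDerivAt (fun s => (f s).re) f'.re t :=
  Complex.reCLM.hasFDerivAt.comp_hasDerivAt t h

theorem HasDerivAt.cim {f : ℝ → ℂ} {f' : ℂ} {t : ℝ} (h : HasDerivAt f f' t) :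
    HasDerivAt (fun s => (f s).im) f'.im t :=
  Complex.imCLM.hasFDerivAt.comp_hasDerivAt t h

/-! ### Geometry of the body frame and of the ratio `θ / sin θ` -/

namespace Pursuit

/-- The position of the target relative to the pursuer, in the frame of the pursuer. -/
noncomputable def relPos (T : ℂ) (p : Pose) : ℂ :=
  (T - p.pos) * Complex.exp (-(p.heading * Complex.I))

theorem leadAngle_eq (T : ℂ) (p : Pose) : leadAngle T p = (relPos T p).arg := rfl

theorem norm_relPos (T : ℂ) (p : Pose) : ‖relPos T p‖ = targetDist T p := by
  have : ‖Complex.exp (-(p.heading * Complex.I))‖ = 1 := by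
    rw [Complex.norm_exp]; simp
  rw [relPos, norm_mul, this, mul_one, targetDist]

theorem relPos_eq_zero_iff {T : ℂ} {p : Pose} : relPos T p = 0 ↔ p.pos = T := by
  rw [← norm_eq_zero, norm_relPos, targetDist, norm_eq_zero, sub_eq_zero, eq_comm]

theorem circAccel_eq (V : ℝ) (T : ℂ) (p : Pose) :
    circAccel V T p = 2 * V ^ 2 * (relPos T p).im / ‖relPos T p‖ ^ 2 := by
  rw [circAccel, leadAngle_eq, Complex.sin_arg, ← norm_relPos]
  ring

theorem estTime_eq (V : ℝ) (T : ℂ) (p : Pose) :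
    estTime V T p = ‖relPos T p‖ ^ 2 * (relPos T p).arg / (V * (relPos T p).im) := by
  rw [estTime, leadAngle_eq, Complex.sin_arg, ← norm_relPos]
  rcases eq_or_ne (relPos T p) 0 with h | h
  · simp [h]
  rcases eq_or_ne (relPos T p).im 0 with h' | h'
  · simp [h']
  rcases eq_or_ne V 0 with hV | hV
  · simp [hV]
  have : ‖relPos T p‖ ≠ 0 := norm_ne_zero_iff.2 h
  field_simp

theorem estTime_eq_re_im (V : ℝ) (T : ℂ) (p : Pose) :
    estTime V T p = ((relPos T p).re ^ 2 + (relPos T p).im ^ 2) * (relPos T p).arg /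
      (V * (relPos T p).im) := by
  rw [estTime_eq, Complex.sq_norm, Complex.normSq_apply, pow_two, pow_two]

theorem arg_div_im_pos {w : ℂ} (hw : w.im ≠ 0) : 0 < w.arg / w.im := by
  rcases lt_or_gt_of_ne hw with h | h
  · exact div_pos_of_neg_of_neg (Complex.arg_neg_iff.2 h) h
  · refine div_pos (lt_of_le_of_ne (Complex.arg_nonneg_iff.2 h.le) fun h0 => hw ?_) h
    exact (Complex.arg_eq_zero_iff.1 h0.symm).2

/-- The left side of the product comparison is `θ / sin θ`, the ratio of arc to chord, so this is
`|sin θ| ≤ |θ|`. -/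
theorem one_le_norm_mul_arg_div_im {w : ℂ} (hw : w.im ≠ 0) : 1 ≤ ‖w‖ * (w.arg / w.im) := by
  have h0 : 0 < ‖w‖ := norm_pos_iff.2 fun h => hw (by simp [h])
  have h1 : |w.im| ≤ ‖w‖ * |w.arg| := by
    rw [← Complex.norm_mul_sin_arg, abs_mul, abs_norm]
    exact mul_le_mul_of_nonneg_left Real.abs_sin_le_abs h0.le
  rw [← abs_of_pos (arg_div_im_pos hw), abs_div, ← mul_div_assoc, le_div_iff₀ (abs_pos.2 hw), one_mul]
  exact h1

/-- This is `θ cot θ ≤ 1`, the sign behind the monotonicity of estimated time plus elapsed time. -/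
theorem re_mul_arg_div_im_le_one {w : ℂ} (hw : w.im ≠ 0) : w.re * (w.arg / w.im) ≤ 1 := by
  have h0 : 0 < ‖w‖ := norm_pos_iff.2 fun h => hw (by simp [h])
  have key : Real.cos |w.arg| * |w.arg| ≤ Real.sin |w.arg| := by
    rw [mul_comm]; exact Real.mul_cos_le_sin (abs_nonneg _) (Complex.abs_arg_le_pi w)
  have hs : ‖w‖ * Real.sin |w.arg| = |w.im| := by
    rw [← Real.abs_sin_eq_sin_abs_of_abs_le_pi (Complex.abs_arg_le_pi w), ← abs_norm, ← abs_mul,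
      Complex.norm_mul_sin_arg]
  rw [← abs_of_pos (arg_div_im_pos hw), abs_div, ← mul_div_assoc, div_le_one (abs_pos.2 hw), ← hs,
    ← Complex.norm_mul_cos_arg, mul_assoc, ← Real.cos_abs]
  exact mul_le_mul_of_nonneg_left key h0.le

/-- Jordan's inequality. The target must not be behind: `θ / sin θ` is unbounded as `θ` approaches
`±π`. -/
theorem norm_mul_arg_div_im_le {w : ℂ} (hw : w.im ≠ 0) (hre : 0 ≤ w.re) :
    ‖w‖ * (w.arg / w.im) ≤ Real.pi / 2 := by
  have key := Real.mul_le_sin (abs_nonneg w.arg) (Complex.abs_arg_le_pi_div_two_iff.2 hre)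
  have hs : ‖w‖ * Real.sin |w.arg| = |w.im| := by
    rw [← Real.abs_sin_eq_sin_abs_of_abs_le_pi (Complex.abs_arg_le_pi w), ← abs_norm, ← abs_mul,
      Complex.norm_mul_sin_arg]
  have h2 := mul_le_mul_of_nonneg_left key (norm_nonneg w)
  rw [hs] at h2
  rw [← abs_of_pos (arg_div_im_pos hw), abs_div, ← mul_div_assoc, div_le_iff₀ (abs_pos.2 hw)]
  have hpi := Real.pi_pos
  calc ‖w‖ * |w.arg| = Real.pi / 2 * (‖w‖ * (2 / Real.pi * |w.arg|)) := by field_simp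
    _ ≤ _ := by gcongr

end Pursuit

/-! ### Motion of a single pursuer -/

namespace Pursuit

/-- The motion `p` of a pursuer with speed `V` and lateral acceleration `α` solves the unicycle
kinematics on `[0, b]` away from the target, the acceleration being between `0` and that of
the circular path. -/
structure IsSingleMotion (V : ℝ) (T : ℂ) (p : ℝ → Pose) (α : ℝ → ℝ) (b : ℝ) : Prop where
  away : ∀ s ∈ Icc 0 b, (p s).pos ≠ T
  pos_deriv : ∀ s ∈ Icc 0 b, HasDerivWithinAt (fun s => (p s).pos)
    ((V * Real.cos (p s).heading : ℝ) + (V * Real.sin (p s).heading : ℝ) * Complex.I) (Ici 0) s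
  integrable : IntervalIntegrable α volume 0 b
  heading_eq : ∀ s ∈ Icc 0 b, (p s).heading = (p 0).heading + ∫ r in (0 : ℝ)..s, α r / V
  law : ∀ᵐ s, s ∈ Icc 0 b → ∃ u ∈ Icc (0 : ℝ) 1, α s = u * circAccel V T (p s)

/-- In the body frame the target recedes along the real axis at speed `V`, and the turning of the
frame contributes a rotation at rate `-κ`. -/
theorem hasDerivAt_relPos {V κ t : ℝ} {T : ℂ} {p : ℝ → Pose}
    (hp : HasDerivAt (fun s => (p s).pos)
      ((V * Real.cos (p t).heading : ℝ) + (V * Real.sin (p t).heading : ℝ) * Complex.I) t)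
    (hh : HasDerivAt (fun s => (p s).heading) κ t) :
    HasDerivAt (fun s => relPos T (p s)) (-V - κ * Complex.I * relPos T (p t)) t := by
  have h1 := hp.const_sub T
  have h2 := ((hh.ofReal_comp.mul_const Complex.I).neg).cexp
  refine (h1.mul h2).congr_deriv ?_
  have h3 : (Complex.cos (p t).heading + Complex.sin (p t).heading * Complex.I) *
      Complex.exp (-((p t).heading * Complex.I)) = 1 := by
    rw [← Complex.exp_mul_I, ← Complex.exp_add, add_neg_cancel, Complex.exp_zero]
  simp only [relPos]
  push_cast
  linear_combination (-V : ℂ) * h3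

namespace IsSingleMotion

variable {V : ℝ} {T : ℂ} {p : ℝ → Pose} {α : ℝ → ℝ} {b : ℝ}

theorem mono (h : IsSingleMotion V T p α b) {c : ℝ} (hc : c ∈ Icc 0 b) :
    IsSingleMotion V T p α c where
  away s hs := h.away s ⟨hs.1, hs.2.trans hc.2⟩
  pos_deriv s hs := h.pos_deriv s ⟨hs.1, hs.2.trans hc.2⟩
  integrable := h.integrable.mono_set (by
    rw [uIcc_of_le hc.1, uIcc_of_le (hc.1.trans hc.2)]; exact Icc_subset_Icc_right hc.2)
  heading_eq s hs := h.heading_eq s ⟨hs.1, hs.2.trans hc.2⟩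
  law := h.law.mono fun s hs hm => hs ⟨hm.1, hm.2.trans hc.2⟩

theorem pos_continuousOn (h : IsSingleMotion V T p α b) :
    ContinuousOn (fun s => (p s).pos) (Icc 0 b) := fun s hs =>
  (h.pos_deriv s hs).continuousWithinAt.mono Icc_subset_Ici_self

theorem pos_lipschitzOnWith (hV : 0 < V) (h : IsSingleMotion V T p α b) :
    LipschitzOnWith V.toNNReal (fun s => (p s).pos) (Icc 0 b) := by
  refine (convex_Icc 0 b).lipschitzOnWith_of_nnnorm_hasDerivWithin_le
    (fun s hs => (h.pos_deriv s hs).mono Icc_subset_Ici_self) fun s _ => ?_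
  rw [← NNReal.coe_le_coe, coe_nnnorm, Real.coe_toNNReal _ hV.le]
  have : (((V * Real.cos (p s).heading : ℝ) : ℂ) +
      (V * Real.sin (p s).heading : ℝ) * Complex.I) =
      V * Complex.exp ((p s).heading * Complex.I) := by
    rw [Complex.exp_mul_I]; push_cast; ring
  rw [this, norm_mul, Complex.norm_exp_ofReal_mul_I, mul_one, Complex.norm_real,
    Real.norm_of_nonneg hV.le]

theorem exists_targetDist_lower (h : IsSingleMotion V T p α b) :
    ∃ r > 0, ∀ s ∈ Icc 0 b, r ≤ targetDist T (p s) := by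
  rcases (Icc 0 b).eq_empty_or_nonempty with he | hne
  · exact ⟨1, one_pos, by simp [he]⟩
  obtain ⟨c, hc, hmin⟩ := isCompact_Icc.exists_isMinOn hne
    ((continuousOn_const.sub h.pos_continuousOn).norm : ContinuousOn (fun s => ‖T - (p s).pos‖) _)
  exact ⟨_, norm_pos_iff.2 (sub_ne_zero.2 (h.away c hc).symm), fun s hs => hmin hs⟩

theorem exists_accel_bound (h : IsSingleMotion V T p α b) :
    ∃ A, 0 ≤ A ∧ ∀ᵐ s, s ∈ Icc 0 b → |α s| ≤ A := by
  obtain ⟨r, hr, hdist⟩ := h.exists_targetDist_lower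
  refine ⟨2 * V ^ 2 / r, by positivity, h.law.mono fun s hs hm => ?_⟩
  obtain ⟨u, hu, hα⟩ := hs hm
  have h1 : |u| ≤ 1 := abs_le.2 ⟨by linarith [hu.1], hu.2⟩
  have h2 := Real.abs_sin_le_one (leadAngle T (p s))
  have h3 : 0 < targetDist T (p s) := hr.trans_le (hdist s hm)
  have h4 : |circAccel V T (p s)| ≤ 2 * V ^ 2 / r := by
    rw [circAccel, abs_div, abs_mul, abs_of_pos h3, abs_of_nonneg (by positivity : 0 ≤ 2 * V ^ 2)]
    refine div_le_div₀ (by positivity) ?_ hr (hdist s hm)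
    exact mul_le_of_le_one_right (by positivity) h2
  rw [hα, abs_mul]
  exact (mul_le_of_le_one_left (abs_nonneg _) h1).trans h4

theorem heading_lipschitz (h : IsSingleMotion V T p α b) :
    ∃ K, LipschitzOnWith K (fun s => (p s).heading) (Icc 0 b) := by
  obtain ⟨A, hA, hb⟩ := h.exists_accel_bound
  refine ⟨(A / |V|).toNNReal, LipschitzOnWith.of_dist_le_mul fun s hs t ht => ?_⟩
  have hint : ∀ c ∈ Icc 0 b, IntervalIntegrable (fun r => α r / V) volume 0 c := fun c hc =>
    (h.mono hc).integrable.div_const V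
  rw [h.heading_eq s hs, h.heading_eq t ht, dist_add_left, dist_eq_norm,
    intervalIntegral.integral_interval_sub_left (hint s hs) (hint t ht), Real.dist_eq,
    Real.coe_toNNReal _ (by positivity)]
  refine intervalIntegral.norm_integral_le_of_norm_le_const_ae (hb.mono fun r hr hm => ?_)
  rw [norm_div, Real.norm_eq_abs, Real.norm_eq_abs]
  have hr' := hr ((uIoc_subset_uIcc.trans (uIcc_subset_Icc ht hs)) hm)
  gcongr

theorem relPos_lipschitz (hV : 0 < V) (h : IsSingleMotion V T p α b) :
    ∃ K, LipschitzOnWith K (fun s => relPos T (p s)) (Icc 0 b) := by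
  obtain ⟨K, hK⟩ := h.heading_lipschitz
  have hf : ContDiff ℝ 1 fun q : ℂ × ℝ => (T - q.1) * Complex.exp (-((q.2 : ℂ) * Complex.I)) := by
    have : ContDiff ℝ 1 fun q : ℂ × ℝ => (q.2 : ℂ) :=
      Complex.ofRealCLM.contDiff.comp contDiff_snd
    fun_prop
  exact ((h.pos_lipschitzOnWith hV).prodMk hK).exists_comp_of_contDiffAt fun _ _ => hf.contDiffAt

theorem ae_hasDerivAt_relPos (hb : 0 ≤ b) (h : IsSingleMotion V T p α b) :
    ∀ᵐ t, t ∈ Ioo 0 b → HasDerivAt (fun s => relPos T (p s))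
      (-V - (α t / V : ℝ) * Complex.I * relPos T (p t)) t := by
  filter_upwards [(h.integrable.div_const V).ae_hasDerivAt_integral] with t ht hm
  have hm' : t ∈ Icc 0 b := Ioo_subset_Icc_self hm
  refine hasDerivAt_relPos ((h.pos_deriv t hm').hasDerivAt (Ici_mem_nhds hm.1)) ?_
  have h1 := (ht (by rwa [uIcc_of_le hb]) 0 left_mem_uIcc).const_add (p 0).heading
  refine h1.congr_of_eventuallyEq ?_
  filter_upwards [Ioo_mem_nhds hm.1 hm.2] with s hs
  exact h.heading_eq s (Ioo_subset_Icc_self hs)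

theorem ae_hasDerivAt_re_im_arg (hb : 0 ≤ b) (h : IsSingleMotion V T p α b) :
    ∀ᵐ t, t ∈ Ioo 0 b →
      HasDerivAt (fun s => (relPos T (p s)).re) (-V + α t / V * (relPos T (p t)).im) t ∧
      HasDerivAt (fun s => (relPos T (p s)).im) (-(α t / V * (relPos T (p t)).re)) t ∧
      ((relPos T (p t)).im ≠ 0 → HasDerivAt (fun s => (relPos T (p s)).arg)
        (V * (relPos T (p t)).im / ((relPos T (p t)).re ^ 2 + (relPos T (p t)).im ^ 2)
          - α t / V) t) := by
  filter_upwards [h.ae_hasDerivAt_relPos hb] with t ht hm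
  have hw := ht hm
  refine ⟨hw.cre.congr_deriv ?_, hw.cim.congr_deriv ?_, fun him =>
    (hw.carg (Or.inr him)).congr_deriv ?_⟩
  · generalize α t / V = κ
    simp
  · generalize α t / V = κ
    simp
  · generalize α t / V = κ
    have hn : (relPos T (p t)).re ^ 2 + (relPos T (p t)).im ^ 2 ≠ 0 := by positivity
    simp only [Complex.div_im, Complex.normSq_apply, ← pow_two]
    simp
    field_simp
    ring

/-- The lead angle, if it is neither `0` nor `π` in the beginning, stays so. -/
theorem im_relPos_ne_zero (hV : 0 < V) (hb : 0 ≤ b) (h : IsSingleMotion V T p α b)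
    (h0 : (relPos T (p 0)).im ≠ 0) : (relPos T (p b)).im ≠ 0 := by
  obtain ⟨r, hr, hdist⟩ := h.exists_targetDist_lower
  obtain ⟨K, hK⟩ := h.relPos_lipschitz hV
  -- A Grönwall weight: with `w = relPos`, `(w.im²)' = -4uV w.re w.im² / ‖w‖² ≥ -(4V / r) w.im²`, so
  -- `w.im² exp(C t)` is nondecreasing and cannot reach `0`.
  set C : ℝ := 4 * V / r with hC
  have hf : ContDiff ℝ 1 fun q : ℝ × ℂ => q.2.im ^ 2 * Real.exp (C * q.1) := by
    have : ContDiff ℝ 1 fun q : ℝ × ℂ => q.2.im := Complex.imCLM.contDiff.comp contDiff_snd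
    fun_prop
  obtain ⟨K', hK'⟩ := ((LipschitzWith.id.lipschitzOnWith (s := Icc 0 b)).prodMk
    hK).exists_comp_of_contDiffAt fun _ _ => hf.contDiffAt
  rw [← uIcc_of_le hb] at hK'
  have key := hK'.absolutelyContinuousOnInterval.le_of_ae_hasDerivAt_nonneg hb (by
    filter_upwards [h.ae_hasDerivAt_re_im_arg hb, h.law] with t ht hl hm
    obtain ⟨u, hu, hα⟩ := hl (Ioo_subset_Icc_self hm)
    have hR : r ≤ ‖relPos T (p t)‖ := by
      rw [norm_relPos]; exact hdist t (Ioo_subset_Icc_self hm)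
    have hd := ((ht hm).2.1.fun_pow 2).fun_mul (((hasDerivAt_id t).const_mul C).exp)
    refine ⟨_, ?_, hd⟩
    rw [circAccel_eq] at hα
    simp only [id]
    generalize relPos T (p t) = w at hα hR
    have hRpos : 0 < ‖w‖ := hr.trans_le hR
    have hre : u * w.re / ‖w‖ ≤ 1 := by
      rw [div_le_one hRpos]
      have := Complex.re_le_norm w
      nlinarith [hu.1, hu.2]
    have hrate : 4 * V / ‖w‖ ≤ C := by rw [hC]; gcongr
    have hα' : α t / V = 2 * u * V * w.im / ‖w‖ ^ 2 := by
      rw [hα]; field_simp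
    have : 0 ≤ w.im ^ 2 * (C - 4 * V / ‖w‖ * (u * w.re / ‖w‖)) := by
      refine mul_nonneg (sq_nonneg _) (sub_nonneg.2 (le_trans ?_ hrate))
      exact mul_le_of_le_one_right (by positivity) hre
    rw [hα']
    have e := mul_nonneg this (Real.exp_pos (C * t)).le
    refine e.trans_eq ?_
    simp only [Nat.cast_ofNat, Nat.reduceSub, pow_one, mul_one]
    field_simp
    ring)
  intro hzero
  simp only [id, hzero, mul_zero, Real.exp_zero, mul_one] at key
  have : 0 < (relPos T (p 0)).im ^ 2 := by positivity
  simp only [ne_eq, OfNat.ofNat_ne_zero, not_false_eq_true, zero_pow, zero_mul] at key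
  linarith

theorem estTime_lipschitz (hV : 0 < V) (h : IsSingleMotion V T p α b)
    (h0 : (relPos T (p 0)).im ≠ 0) :
    ∃ K, LipschitzOnWith K (fun s => estTime V T (p s) + s) (Icc 0 b) := by
  obtain ⟨K, hK⟩ := h.relPos_lipschitz hV
  obtain ⟨K', hK'⟩ := ((LipschitzWith.id.lipschitzOnWith (s := Icc 0 b)).prodMk
    hK).exists_comp_of_contDiffAt (f := fun q : ℝ × ℂ =>
      (q.2.re ^ 2 + q.2.im ^ 2) * q.2.arg / (V * q.2.im) + q.1) fun t ht => by
    have him := (h.mono ht).im_relPos_ne_zero hV ht.1 h0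
    have h1 : ContDiffAt ℝ 1 (fun q : ℝ × ℂ => q.2.im) (id t, relPos T (p t)) :=
      (Complex.imCLM.contDiff.comp contDiff_snd).contDiffAt
    have h2 : ContDiffAt ℝ 1 (fun q : ℝ × ℂ => q.2.re) (id t, relPos T (p t)) :=
      (Complex.reCLM.contDiff.comp contDiff_snd).contDiffAt
    have h3 : ContDiffAt ℝ 1 (fun q : ℝ × ℂ => q.2.arg) (id t, relPos T (p t)) :=
      ContDiffAt.comp (g := Complex.arg) (f := Prod.snd) (id t, relPos T (p t))
        (Complex.contDiffAt_arg (Or.inr him)) contDiffAt_snd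
    refine ((((h2.pow 2).add (h1.pow 2)).mul h3).div (contDiffAt_const.mul h1) ?_).add
      contDiffAt_fst
    exact mul_ne_zero hV.ne' him
  refine ⟨K', ?_⟩
  convert hK' using 2
  exact congrArg (· + _) (estTime_eq_re_im _ _ _)

/-- The factor `1 - u` shows that on the circular path (`u = 1`) the estimate falls exactly as fast
as time passes. -/
theorem ae_hasDerivAt_estTime (hV : 0 < V) (hb : 0 ≤ b) (h : IsSingleMotion V T p α b)
    (h0 : (relPos T (p 0)).im ≠ 0) :
    ∀ᵐ t, t ∈ Ioo 0 b → ∀ u, α t = u * circAccel V T (p t) →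
      HasDerivAt (fun s => estTime V T (p s) + s)
        (2 * (1 - u) * (1 - (relPos T (p t)).re *
          ((relPos T (p t)).arg / (relPos T (p t)).im))) t := by
  filter_upwards [h.ae_hasDerivAt_re_im_arg hb] with t ht hm u hu
  have him := (h.mono (Ioo_subset_Icc_self hm)).im_relPos_ne_zero hV hm.1.le h0
  obtain ⟨hX, hY, hA⟩ := ht hm
  have hd := ((((hX.fun_pow 2).fun_add (hY.fun_pow 2)).fun_mul (hA him)).fun_div
    (hY.const_mul V) (mul_ne_zero hV.ne' him)).fun_add (hasDerivAt_id t)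
  simp only [estTime_eq_re_im]
  refine hd.congr_deriv ?_
  have hα' : α t / V = 2 * u * V * (relPos T (p t)).im /
      ((relPos T (p t)).re ^ 2 + (relPos T (p t)).im ^ 2) := by
    rw [hu, circAccel_eq, Complex.sq_norm, Complex.normSq_apply, ← pow_two, ← pow_two]
    field_simp
  rw [hα']
  have hn : (relPos T (p t)).re ^ 2 + (relPos T (p t)).im ^ 2 ≠ 0 := by positivity
  generalize relPos T (p t) = w at him hn
  norm_num
  field_simp
  ring

/-- The estimated time of interception decreases at rate at most one. -/
theorem estTime_add_le (hV : 0 < V) (hb : 0 ≤ b) (h : IsSingleMotion V T p α b)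
    (h0 : (relPos T (p 0)).im ≠ 0) {c : ℝ} (hc : c ∈ Icc 0 b) :
    estTime V T (p c) + c ≤ estTime V T (p b) + b := by
  obtain ⟨K, hK⟩ := h.estTime_lipschitz hV h0
  have hK' : LipschitzOnWith K (fun s => estTime V T (p s) + s) (uIcc c b) :=
    hK.mono (by rw [uIcc_of_le hc.2]; exact Icc_subset_Icc_left hc.1)
  refine hK'.absolutelyContinuousOnInterval.le_of_ae_hasDerivAt_nonneg hc.2 ?_
  filter_upwards [h.ae_hasDerivAt_estTime hV hb h0, h.law] with t ht hl hm
  have hm' : t ∈ Ioo 0 b := ⟨hc.1.trans_lt hm.1, hm.2⟩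
  obtain ⟨u, hu, hα⟩ := hl (Ioo_subset_Icc_self hm')
  have him := (h.mono (Ioo_subset_Icc_self hm')).im_relPos_ne_zero hV hm'.1.le h0
  exact ⟨_, mul_nonneg (by linarith [hu.2]) (sub_nonneg.2 (re_mul_arg_div_im_le_one him)),
    ht hm' u hα⟩

/-- The distance to the target increases while the target is behind. -/
theorem norm_relPos_le (hV : 0 < V) (hb : 0 ≤ b) (h : IsSingleMotion V T p α b) {c : ℝ}
    (hc : c ∈ Icc 0 b) (hre : ∀ s ∈ Ioo c b, (relPos T (p s)).re ≤ 0) :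
    ‖relPos T (p c)‖ ≤ ‖relPos T (p b)‖ := by
  obtain ⟨K, hK⟩ := h.relPos_lipschitz hV
  have hf : ContDiff ℝ 1 fun w : ℂ => w.re ^ 2 + w.im ^ 2 := by
    have h1 : ContDiff ℝ 1 fun w : ℂ => w.im := Complex.imCLM.contDiff
    have h2 : ContDiff ℝ 1 fun w : ℂ => w.re := Complex.reCLM.contDiff
    fun_prop
  obtain ⟨K', hK'⟩ := hK.exists_comp_of_contDiffAt fun _ _ => hf.contDiffAt
  have hK'' := hK'.mono (by
    rw [uIcc_of_le hc.2]; exact Icc_subset_Icc_left hc.1 : uIcc c b ⊆ Icc 0 b)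
  have key := hK''.absolutelyContinuousOnInterval.le_of_ae_hasDerivAt_nonneg hc.2 (by
    filter_upwards [h.ae_hasDerivAt_re_im_arg hb] with t ht hm
    obtain ⟨hX, hY, -⟩ := ht ⟨hc.1.trans_lt hm.1, hm.2⟩
    refine ⟨_, ?_, (hX.fun_pow 2).fun_add (hY.fun_pow 2)⟩
    have := mul_nonneg hV.le (neg_nonneg.2 (hre t hm))
    norm_num
    linarith)
  simp only [pow_two, ← Complex.normSq_apply] at key
  rw [Complex.norm_def, Complex.norm_def]
  exact Real.sqrt_le_sqrt key

/-- A pursuer that moves straight keeps its distance to the line of sight parallel to its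
heading. -/
theorem im_relPos_eq (hV : 0 < V) (hb : 0 ≤ b) (h : IsSingleMotion V T p α b) {c : ℝ}
    (hc : c ∈ Icc 0 b) (hα : ∀ᵐ s, s ∈ Ioo c b → α s = 0) :
    (relPos T (p c)).im = (relPos T (p b)).im := by
  obtain ⟨K, hK⟩ := h.relPos_lipschitz hV
  obtain ⟨K', hK'⟩ := hK.exists_comp_of_contDiffAt fun _ _ =>
    (Complex.imCLM.contDiff (n := 1)).contDiffAt
  have hK'' := hK'.mono (by
    rw [uIcc_of_le hc.2]; exact Icc_subset_Icc_left hc.1 : uIcc c b ⊆ Icc 0 b)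
  refine hK''.absolutelyContinuousOnInterval.eq_of_ae_hasDerivAt_zero hc.2 ?_
  filter_upwards [h.ae_hasDerivAt_re_im_arg hb, hα] with t ht ha hm
  simpa [ha hm] using (ht ⟨hc.1.trans_lt hm.1, hm.2⟩).2.1

end IsSingleMotion
end Pursuit

/-! ### The group of pursuers up to the first interception -/

namespace Pursuit

theorem estTime_eq_norm_mul (V : ℝ) (T : ℂ) (p : Pose) : estTime V T p =
    ‖relPos T p‖ * (‖relPos T p‖ * ((relPos T p).arg / (relPos T p).im)) / V := by
  rw [estTime_eq, mul_comm V, ← div_div]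
  ring

theorem norm_relPos_le_mul_estTime {V : ℝ} (hV : 0 < V) {T : ℂ} {p : Pose}
    (h : (relPos T p).im ≠ 0) : ‖relPos T p‖ ≤ V * estTime V T p := by
  rw [estTime_eq_norm_mul, mul_div_cancel₀ _ hV.ne']
  exact le_mul_of_one_le_right (norm_nonneg _) (one_le_norm_mul_arg_div_im h)

theorem estTime_pos {V : ℝ} (hV : 0 < V) {T : ℂ} {p : Pose}
    (h : (relPos T p).im ≠ 0) : 0 < estTime V T p := by
  have h0 : 0 < ‖relPos T p‖ := norm_pos_iff.2 fun h' => h (by simp [h'])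
  exact pos_of_mul_pos_right (h0.trans_le (norm_relPos_le_mul_estTime hV h)) hV.le

theorem im_relPos_ne_zero_of_leadAngle {T : ℂ} {p : Pose}
    (h : leadAngle T p ≠ 0 ∧ leadAngle T p ≠ Real.pi) : (relPos T p).im ≠ 0 := by
  intro h0
  rcases le_or_gt 0 (relPos T p).re with h1 | h1
  · exact h.1 (Complex.arg_eq_zero_iff.2 ⟨h1, h0⟩)
  · exact h.2 (Complex.arg_eq_pi_iff.2 ⟨h1, h0⟩)

variable {n : ℕ} {V : Fin n → ℝ} {T : ℂ} {G : ℝ → Digraph (Fin n)} {x : ℝ → Fin n → Pose}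
  {a : ℝ → Fin n → ℝ}

theorem GuidanceLaw.exists_eq_mul {H : Digraph (Fin n)} {p : Fin n → Pose} {i : Fin n} {α : ℝ}
    (h : GuidanceLaw V T H p i α) : ∃ u ∈ Icc (0 : ℝ) 1, α = u * circAccel (V i) T (p i) := by
  by_cases hj : ∃ j, H.Adj i j ∧ estTime (V i) T (p i) < estTime (V j) T (p j)
  · exact ⟨0, by simp, by simp [h.1 hj]⟩
  · push Not at hj
    rcases h.2 hj with h | ⟨-, c, u, hc, hu, hcu, rfl⟩
    · exact ⟨1, by simp, by simp [h]⟩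
    · exact ⟨u, ⟨hu, by linarith⟩, by simp⟩

/-- Ties along the chain carry the value of `i` to a node with a larger out-neighbour. Hence the
chattering relaxation never applies to a leader. -/
theorem TiedToStraight.not_isLeader {H : Digraph (Fin n)} {p : Fin n → Pose} {i : Fin n}
    (h : TiedToStraight H (fun j => estTime (V j) T (p j)) i) : ¬ IsLeader V T p i := by
  intro hi
  obtain ⟨q, hq, j, -, hj⟩ := h
  have hq' : estTime (V q) T (p q) = estTime (V i) T (p i) := by
    clear hj
    induction hq with
    | refl => rfl
    | tail _ h ih => exact h.2.trans ih
  exact (hi j).not_gt (by simpa [hq'] using hj)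

theorem GuidanceLaw.eq_circAccel {H : Digraph (Fin n)} {p : Fin n → Pose} {i : Fin n} {α : ℝ}
    (h : GuidanceLaw V T H p i α) (hi : IsLeader V T p i) : α = circAccel (V i) T (p i) := by
  rcases h.2 fun j _ => hi j with h | h
  · exact h
  · exact (h.1.not_isLeader hi).elim

theorem Engaged.mono {s t : ℝ} (h : Engaged T x t) (hs : s ∈ Icc 0 t) : Engaged T x s :=
  ⟨hs.1, fun r hr => h.2 r ⟨hr.1, hr.2.trans hs.2⟩⟩

namespace IsGuidedMotion

theorem isSingleMotion (hx : IsGuidedMotion V T G x a) {t : ℝ} (ht : Engaged T x t) (i : Fin n) :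
    IsSingleMotion (V i) T (fun s => x s i) (fun s => a s i) t where
  away s hs := ht.2 s hs i
  pos_deriv s hs := hx.pos_deriv i s (ht.mono hs)
  integrable := hx.accel_integrable i t ht
  heading_eq s hs := hx.heading_eq i s (ht.mono hs)
  law := (hx.law i).mono fun _ hs hm => (hs (ht.mono hm)).exists_eq_mul

theorem im_ne_zero (hV : ∀ i, 0 < V i) (hx : IsGuidedMotion V T G x a)
    (h0 : ∀ i, (relPos T (x 0 i)).im ≠ 0) {t : ℝ} (ht : Engaged T x t) (i : Fin n) :
    (relPos T (x t i)).im ≠ 0 :=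
  (hx.isSingleMotion ht i).im_relPos_ne_zero (hV i) ht.1 (h0 i)

theorem estTime_pos (hV : ∀ i, 0 < V i) (hx : IsGuidedMotion V T G x a)
    (h0 : ∀ i, (relPos T (x 0 i)).im ≠ 0) {t : ℝ} (ht : Engaged T x t) (i : Fin n) :
    0 < estTime (V i) T (x t i) :=
  Pursuit.estTime_pos (hV i) (hx.im_ne_zero hV h0 ht i)

theorem estTime_add_le (hV : ∀ i, 0 < V i) (hx : IsGuidedMotion V T G x a)
    (h0 : ∀ i, (relPos T (x 0 i)).im ≠ 0) {s t : ℝ} (ht : Engaged T x t) (hs : s ∈ Icc 0 t)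
    (i : Fin n) : estTime (V i) T (x s i) + s ≤ estTime (V i) T (x t i) + t :=
  (hx.isSingleMotion ht i).estTime_add_le (hV i) ht.1 (h0 i) hs

/-- The largest estimated time of interception decreases at rate one. -/
theorem estTime_add_le_of_isLeader (hV : ∀ i, 0 < V i) (hx : IsGuidedMotion V T G x a)
    (h0 : ∀ i, (relPos T (x 0 i)).im ≠ 0) {l : Fin n} (hl : IsLeader V T (x 0) l) {b : ℝ}
    (hb : Engaged T x b) (i : Fin n) :
    estTime (V i) T (x b i) + b ≤ estTime (V l) T (x 0 l) := by
  have hne : (Finset.univ : Finset (Fin n)).Nonempty := ⟨l, Finset.mem_univ l⟩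
  set φ : ℝ → ℝ := fun s => Finset.univ.sup' hne fun i => estTime (V i) T (x s i) + s with hφ
  have hle : ∀ i s, estTime (V i) T (x s i) + s ≤ φ s := fun i s =>
    Finset.le_sup' (fun i => estTime (V i) T (x s i) + s) (Finset.mem_univ i)
  have hlip : ∀ i, ∃ K, LipschitzOnWith K (fun s => estTime (V i) T (x s i) + s) (Icc 0 b) :=
    fun i => (hx.isSingleMotion hb i).estTime_lipschitz (hV i) (h0 i)
  choose K hK using hlip
  have hφlip : LipschitzOnWith (Finset.univ.sup K) φ (uIcc 0 b) := by
    rw [uIcc_of_le hb.1]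
    refine LipschitzOnWith.of_le_add_mul _ fun s hs t ht => Finset.sup'_le _ _ fun i _ => ?_
    refine ((hK i).le_add_mul hs ht).trans (add_le_add (hle i t) ?_)
    have : (K i : ℝ) ≤ (Finset.univ.sup K : NNReal) :=
      NNReal.coe_le_coe.2 (Finset.le_sup (Finset.mem_univ i))
    gcongr
  have hac := hφlip.absolutelyContinuousOnInterval
  have hconst : φ 0 = φ b := by
    refine hac.eq_of_ae_hasDerivAt_zero hb.1 ?_
    have h1 := ae_all_iff.2 fun i =>
      (hx.isSingleMotion hb i).ae_hasDerivAt_estTime (hV i) hb.1 (h0 i)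
    filter_upwards [hac.ae_differentiableAt, h1, ae_all_iff.2 hx.law] with t hd hz hlaw hm
    have hmem : t ∈ uIcc 0 b := by rw [uIcc_of_le hb.1]; exact Ioo_subset_Icc_self hm
    obtain ⟨i, -, hi⟩ := Finset.exists_mem_eq_sup' hne fun i => estTime (V i) T (x t i) + t
    have hlead : IsLeader V T (x t) i := fun j => by
      have := hle j t
      rw [hφ] at this
      simp only [hi] at this
      linarith
    have hai := (hlaw i (hb.mono (Ioo_subset_Icc_self hm))).eq_circAccel hlead
    have hzi := hz i hm 1 (by simpa using hai)
    -- The maximum `φ` lies above the curve of `i` and touches it at `t`, so where both are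
    -- differentiable their derivatives agree.
    have hmin : IsLocalMin (fun s => φ s - (estTime (V i) T (x s i) + s)) t := by
      refine Eventually.of_forall fun s => ?_
      have : φ t = estTime (V i) T (x t i) + t := hi
      simp only [this, sub_self, sub_nonneg]
      exact hle i s
    have hzero := hmin.hasDerivAt_eq_zero ((hd hmem).hasDerivAt.fun_sub hzi)
    have : deriv φ t = 0 := by linarith
    rw [← this]
    exact (hd hmem).hasDerivAt
  refine (hle i b).trans (hconst.symm.le.trans (Finset.sup'_le _ _ fun j _ => ?_))
  simpa using hl j

theorem estTime_add_eq_of_isLeader (hV : ∀ i, 0 < V i) (hx : IsGuidedMotion V T G x a)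
    (h0 : ∀ i, (relPos T (x 0 i)).im ≠ 0) {l : Fin n} (hl : IsLeader V T (x 0) l) {b : ℝ}
    (hb : Engaged T x b) : estTime (V l) T (x b l) + b = estTime (V l) T (x 0 l) := by
  refine le_antisymm (hx.estTime_add_le_of_isLeader hV h0 hl hb l) ?_
  simpa using hx.estTime_add_le hV h0 hb ⟨le_rfl, hb.1⟩ l

/-- There is a first interception, at the latest at the initial estimated time of the leader. -/
theorem exists_first_interception (hV : ∀ i, 0 < V i) (hx : IsGuidedMotion V T G x a)
    (h0 : ∀ i, (relPos T (x 0 i)).im ≠ 0) {l : Fin n} (hl : IsLeader V T (x 0) l) :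
    ∃ tc, 0 < tc ∧ tc ≤ estTime (V l) T (x 0 l) ∧ (∀ s ∈ Ico 0 tc, Engaged T x s) ∧
      ∃ i, (x tc i).pos = T := by
  set tf := estTime (V l) T (x 0 l)
  have htf : 0 < tf := Pursuit.estTime_pos (hV l) (h0 l)
  set S : Set ℝ := ⋃ i, Icc 0 tf ∩ (fun s => (x s i).pos) ⁻¹' {T}
  have hS : IsCompact S := isCompact_iUnion fun i =>
    isCompact_Icc.of_isClosed_subset (((hx.pos_continuous i).mono
      Icc_subset_Ici_self).preimage_isClosed_of_isClosed isClosed_Icc isClosed_singleton)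
      inter_subset_left
  have hne : S.Nonempty := by
    by_contra hcon
    have heng : Engaged T x tf := ⟨htf.le, fun s hs i hi =>
      hcon ⟨s, mem_iUnion.2 ⟨i, hs, hi⟩⟩⟩
    have := hx.estTime_add_eq_of_isLeader hV h0 hl heng
    have := hx.estTime_pos hV h0 heng l
    linarith
  obtain ⟨tc, hmem, hleast⟩ := hS.exists_isLeast hne
  obtain ⟨i, htc, hi⟩ := mem_iUnion.1 hmem
  refine ⟨tc, lt_of_le_of_ne htc.1 ?_, htc.2, fun s hs => ⟨hs.1, fun r hr j hj => ?_⟩, i, hi⟩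
  · rintro rfl
    have : relPos T (x 0 i) = 0 := relPos_eq_zero_iff.2 hi
    exact h0 i (by simp [this])
  · have : tc ≤ r := hleast (mem_iUnion.2
      ⟨j, ⟨hr.1, hr.2.trans (hs.2.le.trans htc.2)⟩, hj⟩)
    linarith [hr.2, hs.2]

theorem tendsto_norm_relPos (hx : IsGuidedMotion V T G x a) {tc : ℝ} (htc : 0 < tc) (i : Fin n) :
    Tendsto (fun s => ‖relPos T (x s i)‖) (𝓝[<] tc) (𝓝 ‖T - (x tc i).pos‖) := by
  simp only [norm_relPos, targetDist]
  have h1 : Tendsto (fun s => (x s i).pos) (𝓝[<] tc) (𝓝 (x tc i).pos) :=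
    ((hx.pos_continuous i).continuousAt (Ici_mem_nhds htc)).tendsto.mono_left nhdsWithin_le_nhds
  exact (h1.const_sub T).norm

/-- A pursuer that intercepts first cannot be expected later. -/
theorem estTime_add_le_of_interception (hV : ∀ i, 0 < V i) (hx : IsGuidedMotion V T G x a)
    (h0 : ∀ i, (relPos T (x 0 i)).im ≠ 0) {tc : ℝ} (htc : 0 < tc)
    (heng : ∀ s ∈ Ico 0 tc, Engaged T x s) {i : Fin n} (hi : (x tc i).pos = T) {c : ℝ}
    (hc : c ∈ Ico 0 tc) : estTime (V i) T (x c i) + c ≤ tc := by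
  by_contra! hlt
  have hlim := hx.tendsto_norm_relPos htc i
  rw [hi, sub_self, norm_zero] at hlim
  have hpi := Real.pi_pos
  have hsmall : ∀ᶠ s in 𝓝[<] tc, ‖relPos T (x s i)‖ * (Real.pi / 2) / V i <
      estTime (V i) T (x c i) + c - tc := by
    refine Tendsto.eventually_lt_const (v := 0) (by linarith) ?_
    simpa using (hlim.mul_const (Real.pi / 2)).div_const (V i)
  obtain ⟨d, hd, hdI⟩ := (mem_nhdsLT_iff_exists_Ioo_subset' hc.2).1 hsmall
  -- With the target in front, the estimate would be at most `πR / (2V)`, which tends to `0`,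
  -- whereas monotonicity keeps it above a positive constant.
  have hback : ∀ s ∈ Ioo (max c d) tc, (relPos T (x s i)).re ≤ 0 := by
    intro s hs
    by_contra! hre
    have hs0 : s ∈ Ico 0 tc := ⟨hc.1.trans ((le_max_left _ _).trans hs.1.le), hs.2⟩
    have h1 := hx.estTime_add_le hV h0 (heng s hs0) ⟨hc.1, (le_max_left _ _).trans hs.1.le⟩ i
    have h2 := hdI ⟨(le_max_right _ _).trans_lt hs.1, hs.2⟩
    have h3 := norm_mul_arg_div_im_le (hx.im_ne_zero hV h0 (heng s hs0) i) hre.le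
    have h4 : estTime (V i) T (x s i) ≤ ‖relPos T (x s i)‖ * (Real.pi / 2) / V i := by
      rw [estTime_eq_norm_mul]
      have := hV i
      gcongr
    simp only [mem_ofPred_eq] at h2
    linarith [hs.2]
  obtain ⟨r, hr⟩ := exists_between (max_lt hc.2 hd)
  have hr0 : r ∈ Ico 0 tc := ⟨hc.1.trans ((le_max_left _ _).trans hr.1.le), hr.2⟩
  -- With the target behind, the distance cannot decrease, so it cannot tend to `0` from its
  -- positive value at `r`.
  have hge : ∀ᶠ s in 𝓝[<] tc, ‖relPos T (x r i)‖ ≤ ‖relPos T (x s i)‖ := by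
    filter_upwards [Ioo_mem_nhdsLT hr.2] with s hs
    have hs0 : s ∈ Ico 0 tc := ⟨hr0.1.trans hs.1.le, hs.2⟩
    exact (hx.isSingleMotion (heng s hs0) i).norm_relPos_le (hV i) hs0.1 ⟨hr0.1, hs.1.le⟩
      fun q hq => hback q ⟨hr.1.trans hq.1, hq.2.trans hs.2⟩
  have hle := ge_of_tendsto hlim hge
  have him := hx.im_ne_zero hV h0 (heng r hr0) i
  rw [norm_le_zero_iff] at hle
  exact him (by rw [hle]; rfl)

/-- A pursuer that moves straight does not come close to the target. -/
theorem not_ae_straight (hV : ∀ i, 0 < V i) (hx : IsGuidedMotion V T G x a)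
    (h0 : ∀ i, (relPos T (x 0 i)).im ≠ 0) {c tc : ℝ} (hc : c ∈ Ico 0 tc)
    (heng : ∀ s ∈ Ico 0 tc, Engaged T x s) {i : Fin n}
    (hle : ∀ s ∈ Ico c tc, estTime (V i) T (x s i) + s ≤ tc)
    (hstr : ∀ᵐ s, s ∈ Ioo c tc → a s i = 0) : False := by
  have him := hx.im_ne_zero hV h0 (heng c hc) i
  have key : ∀ᶠ s in 𝓝[<] tc, |(relPos T (x c i)).im| ≤ V i * (tc - s) := by
    filter_upwards [Ioo_mem_nhdsLT hc.2] with s hs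
    have hs0 : s ∈ Ico 0 tc := ⟨hc.1.trans hs.1.le, hs.2⟩
    rw [(hx.isSingleMotion (heng s hs0) i).im_relPos_eq (hV i) hs0.1 ⟨hc.1, hs.1.le⟩
      (hstr.mono fun r h hr => h ⟨hr.1, hr.2.trans hs.2⟩)]
    refine (Complex.abs_im_le_norm _).trans ((norm_relPos_le_mul_estTime (hV i)
      (hx.im_ne_zero hV h0 (heng s hs0) i)).trans ?_)
    exact mul_le_mul_of_nonneg_left (by linarith [hle s ⟨hs.1.le, hs.2⟩]) (hV i).le
  have hlim : Tendsto (fun s => V i * (tc - s)) (𝓝[<] tc) (𝓝 (V i * (tc - tc))) :=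
    (Continuous.tendsto (by fun_prop) tc).mono_left nhdsWithin_le_nhds
  have := ge_of_tendsto hlim key
  rw [sub_self, mul_zero] at this
  exact him (abs_nonpos_iff.1 this)

end IsGuidedMotion

/-! ### Losses of reachability and consensus before the first interception -/

/-- Separated half-open intervals cover an open interval only if one of them does. -/
theorem exists_Ioo_subset_Ico_of_subset_iUnion {N : ℕ∞} {t δ : ℕ → ℝ}
    (ht : ∀ m : ℕ, (m : ℕ∞) < N → 0 < δ m)
    (hgap : ∀ m : ℕ, ((m + 1 : ℕ) : ℕ∞) < N → t m + δ m < t (m + 1)) {c d : ℝ} (hcd : c < d)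
    (hcov : ∀ s ∈ Ioo c d, ∃ m : ℕ, (m : ℕ∞) < N ∧ s ∈ Ico (t m) (t m + δ m)) :
    ∃ m : ℕ, (m : ℕ∞) < N ∧ Ioo c d ⊆ Ico (t m) (t m + δ m) := by
  have hlt : ∀ m k : ℕ, (k : ℕ∞) < N → m < k → t m + δ m < t k := by
    intro m k hk hmk
    induction k, hmk using Nat.le_induction with
    | base => exact hgap m hk
    | succ k hmk ih =>
      have hk' : (k : ℕ∞) < N := lt_of_le_of_lt (by exact_mod_cast k.le_succ) hk
      linarith [ih hk', hgap k hk, ht k hk']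
  have hkey : ∀ s ∈ Ioo c d, ∀ r ∈ Ioo c d, ∀ m k : ℕ, (m : ℕ∞) < N → (k : ℕ∞) < N →
      s ∈ Ico (t m) (t m + δ m) → r ∈ Ico (t k) (t k + δ k) → ¬ m < k := by
    intro s hs r hr m k hm hk hsm hrk hmk
    have h1 := hlt m k hk hmk
    -- The right endpoint of the `m`-th interval lies in the covered range, yet no interval contains
    -- it, being half-open and strictly separated.
    obtain ⟨j, hj, hjm⟩ := hcov (t m + δ m) ⟨by linarith [hs.1, hsm.2], by linarith [hr.2, hrk.1]⟩
    rcases lt_trichotomy j m with h | h | h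
    · linarith [hlt j m hm h, hjm.2, ht m hm]
    · subst h; exact lt_irrefl _ hjm.2
    · linarith [hlt m j hj h, hjm.1]
  obtain ⟨s, hs⟩ := exists_between hcd
  obtain ⟨m, hm, hsm⟩ := hcov s hs
  refine ⟨m, hm, fun r hr => ?_⟩
  obtain ⟨k, hk, hrk⟩ := hcov r hr
  have : m = k := le_antisymm (not_lt.1 (hkey r hr s hs k m hk hm hrk hsm))
    (not_lt.1 (hkey s hs r hr m k hm hk hsm hrk))
  rwa [this]

end Pursuit

theorem Relation.ReflTransGen.exists_exit {α : Type*} {r : α → α → Prop} {p : α → Prop} {a b : α}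
    (h : Relation.ReflTransGen r a b) (ha : p a) (hb : ¬ p b) : ∃ u v, r u v ∧ p u ∧ ¬ p v := by
  by_contra! hcon
  refine hb ?_
  induction h with
  | refl => exact ha
  | tail _ h ih => exact hcon _ _ h (by_contra fun hn => absurd (ih hn) hn)

namespace Pursuit

variable {n : ℕ} {V : Fin n → ℝ} {T : ℂ} {G : ℝ → Digraph (Fin n)} {x : ℝ → Fin n → Pose}
  {a : ℝ → Fin n → ℝ}

/-- Until the first interception at `tc`, the leader is globally reachable at times close to
`tc`. -/
theorem exists_leaderReachable {tc : ℝ} (heng : ∀ s ∈ Ico 0 tc, Engaged T x s) {i : Fin n}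
    (hi : ∀ s ∈ Ico 0 tc, estTime (V i) T (x s i) + s ≤ tc) {N : ℕ∞} {t δ : ℕ → ℝ}
    (ht : ∀ m : ℕ, (m : ℕ∞) < N → 0 ≤ t m ∧ 0 < δ m)
    (hgap : ∀ m : ℕ, ((m + 1 : ℕ) : ℕ∞) < N → t m + δ m < t (m + 1))
    (hreach : ∀ s, Engaged T x s →
      (∀ m : ℕ, (m : ℕ∞) < N → s ∉ Ico (t m) (t m + δ m)) → LeaderReachable V T (G s) (x s))
    (hδ : ∀ m : ℕ, (m : ℕ∞) < N → Engaged T x (t m) →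
      ∀ i, δ m < estTime (V i) T (x (t m) i)) {c : ℝ} (hc : c ∈ Ico 0 tc) :
    ∃ s ∈ Ioo c tc, LeaderReachable V T (G s) (x s) := by
  by_contra! hcon
  obtain ⟨m, hm, hsub⟩ := exists_Ioo_subset_Ico_of_subset_iUnion (fun m hm => (ht m hm).2) hgap
    hc.2 fun s hs => by
      by_contra! hs'
      exact hcon s hs (hreach s (heng s ⟨hc.1.trans hs.1.le, hs.2⟩) hs')
  obtain ⟨r, hr⟩ := exists_between hc.2
  have hlt : t m < tc := (hsub hr).1.trans_lt hr.2
  have hmem : t m ∈ Ico 0 tc := ⟨(ht m hm).1, hlt⟩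
  have hend : tc ≤ t m + δ m := le_of_forall_lt fun q hq => by
    have hq' : max r q ∈ Ioo c tc := ⟨hr.1.trans_le (le_max_left _ _), max_lt hr.2 hq⟩
    exact (le_max_right _ _).trans_lt (hsub hq').2
  linarith [hδ m hm (heng _ hmem) i, hi _ hmem]

theorem IsGuidedMotion.exists_leader_time (hV : ∀ i, 0 < V i) (hG : IsSwitchingDigraph G)
    (hx : IsGuidedMotion V T G x a) (h0 : ∀ i, (relPos T (x 0 i)).im ≠ 0) {N : ℕ∞} {t δ : ℕ → ℝ}
    (ht : ∀ m : ℕ, (m : ℕ∞) < N → 0 ≤ t m ∧ 0 < δ m)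
    (hgap : ∀ m : ℕ, ((m + 1 : ℕ) : ℕ∞) < N → t m + δ m < t (m + 1))
    (hreach : ∀ s, Engaged T x s →
      (∀ m : ℕ, (m : ℕ∞) < N → s ∉ Ico (t m) (t m + δ m)) → LeaderReachable V T (G s) (x s))
    (hδ : ∀ m : ℕ, (m : ℕ∞) < N → Engaged T x (t m) →
      ∀ i, δ m < estTime (V i) T (x (t m) i))
    {l : Fin n} (hl : IsLeader V T (x 0) l) {tc : ℝ} (htc : 0 < tc)
    (htcf : tc ≤ estTime (V l) T (x 0 l)) (heng : ∀ s ∈ Ico 0 tc, Engaged T x s)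
    {i₀ : Fin n} (hi₀ : (x tc i₀).pos = T) (i : Fin n) :
    ∃ s ∈ Ico 0 tc, estTime (V l) T (x 0 l) ≤ estTime (V i) T (x s i) + s := by
  set tf := estTime (V l) T (x 0 l)
  set z : Fin n → ℝ → ℝ := fun j s => estTime (V j) T (x s j) + s
  have hzmono : ∀ j, ∀ r ∈ Ico 0 tc, ∀ s ∈ Ico 0 tc, r ≤ s → z j r ≤ z j s :=
    fun j r hr s hs hrs => hx.estTime_add_le hV h0 (heng s hs) ⟨hr.1, hrs⟩ j
  have hzle : ∀ j, ∀ s ∈ Ico 0 tc, z j s ≤ tf := fun j s hs =>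
    hx.estTime_add_le_of_isLeader hV h0 hl (heng s hs) j
  -- Upward-closed conditions on a monotone `z j` persist once attained, so the finitely many
  -- thresholds are all settled shortly before `tc`.
  have hev : ∀ j (A : ℝ → Prop), (∀ r s, r ≤ s → A r → A s) → (∃ s ∈ Ico 0 tc, A (z j s)) →
      ∀ᶠ s in 𝓝[<] tc, A (z j s) := by
    rintro j A hA ⟨r, hr, hAr⟩
    filter_upwards [Ioo_mem_nhdsLT hr.2] with s hs
    exact hA _ _ (hzmono j r hr s ⟨hr.1.trans hs.1.le, hs.2⟩ hs.1.le) hAr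
  by_contra hnot
  obtain ⟨H, hH⟩ := hG.left tc htc
  have hall : ∀ᶠ s in 𝓝[<] tc, G s = H ∧
      (∀ j, (∃ r ∈ Ico 0 tc, tf ≤ z j r) → tf ≤ z j s) ∧
      (∀ j, (∃ r ∈ Ico 0 tc, tc < z j r) → tc < z j s) := by
    refine hH.and (.and (eventually_all.2 fun j => ?_) (eventually_all.2 fun j => ?_))
    · exact eventually_imp_distrib_left.2 (hev j (tf ≤ ·) fun r s h h' => h'.trans h)
    · exact eventually_imp_distrib_left.2 (hev j (tc < ·) fun r s h h' => h'.trans_le h)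
  obtain ⟨c', hc', hsub⟩ := (mem_nhdsLT_iff_exists_Ioo_subset' htc).1 hall
  obtain ⟨c, hcc⟩ := exists_between (max_lt htc hc')
  have hc : c ∈ Ico 0 tc := ⟨(le_max_left _ _).trans hcc.1.le, hcc.2⟩
  have hnear : ∀ s ∈ Ioo c tc, s ∈ Ico 0 tc ∧ G s = H ∧
      (∀ j, (∃ r ∈ Ico 0 tc, tf ≤ z j r) → tf ≤ z j s) ∧
      (∀ j, (∃ r ∈ Ico 0 tc, tc < z j r) → tc < z j s) := fun s hs =>
    ⟨⟨hc.1.trans hs.1.le, hs.2⟩,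
      hsub ⟨(le_max_right _ _).trans_lt (hcc.1.trans hs.1), hs.2⟩⟩
  have hint : ∀ s ∈ Ico 0 tc, z i₀ s ≤ tc := fun s hs =>
    hx.estTime_add_le_of_interception hV h0 htc heng hi₀ hs
  obtain ⟨s, hs, k, hk, hreachk⟩ := exists_leaderReachable heng hint ht hgap hreach hδ hc
  obtain ⟨hs0, hGs, -⟩ := hnear s hs
  have hkL : ∃ r ∈ Ico 0 tc, tf ≤ z k r := by
    refine ⟨s, hs0, ?_⟩
    have := hx.estTime_add_eq_of_isLeader hV h0 hl (heng s hs0)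
    have := hk l
    change tf ≤ estTime (V k) T (x s k) + s
    linarith
  -- The bound by `tc` is what lets `not_ae_straight` apply; a pursuer with `z > tc` may move
  -- straight up to `tc` without contradiction.
  let S : Fin n → Prop := fun j => (¬ ∃ r ∈ Ico 0 tc, tf ≤ z j r) ∧ ∀ r ∈ Ico 0 tc, z j r ≤ tc
  have hS : ∃ j, S j := by
    -- If `tc < tf`, the intercepting pursuer is in `S`; if `tc = tf`, the bound `z ≤ tf` puts the
    -- assumed laggard `i` there.
    rcases htcf.lt_or_eq with h | h
    · exact ⟨i₀, fun ⟨r, hr, hle⟩ => by linarith [hint r hr], hint⟩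
    · exact ⟨i, hnot, fun r hr => by rw [h]; exact hzle i r hr⟩
  obtain ⟨j, hj⟩ := hS
  obtain ⟨u, v, huv, hu, hv⟩ := (hreachk j).exists_exit hj fun h => h.1 hkL
  have hlt : ∀ r ∈ Ioo c tc, estTime (V u) T (x r u) < estTime (V v) T (x r v) := by
    intro r hr
    obtain ⟨hr0, -, h1, h2⟩ := hnear r hr
    suffices z u r < z v r by simpa [z] using this
    by_cases hvL : ∃ q ∈ Ico 0 tc, tf ≤ z v q
    · refine lt_of_lt_of_le ?_ (h1 v hvL)
      by_contra! hcon
      exact hu.1 ⟨r, hr0, hcon⟩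
    · have : ∃ q ∈ Ico 0 tc, tc < z v q := by
        by_contra! hcon
        exact hv ⟨hvL, hcon⟩
      exact (hu.2 r hr0).trans_lt (h2 v this)
  refine hx.not_ae_straight hV h0 hc heng (i := u)
    (fun r hr => hu.2 r ⟨hc.1.trans hr.1, hr.2⟩) ?_
  filter_upwards [hx.law u] with r hlaw hr
  obtain ⟨hr0, hGr, -⟩ := hnear r hr
  refine (hlaw (heng r hr0)).1 ⟨v, ?_, hlt r hr⟩
  rwa [hGr, ← hGs]

end Pursuit

/-- `N` is the (possibly infinite) number of losses of global reachability of the leader;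
the `m`-th one starts at `t m` and lasts `δ m`. -/
theorem mainTheorem2 {n : ℕ} (V : Fin n → ℝ) (hV : ∀ i, 0 < V i) (T : ℂ)
    (G : ℝ → Digraph (Fin n)) (hG : Pursuit.IsSwitchingDigraph G)
    (x : ℝ → Fin n → Pursuit.Pose) (a : ℝ → Fin n → ℝ)
    (hx : Pursuit.IsGuidedMotion V T G x a)
    (hθ : ∀ i, Pursuit.leadAngle T (x 0 i) ≠ 0 ∧ Pursuit.leadAngle T (x 0 i) ≠ Real.pi)
    (N : ℕ∞) (t δ : ℕ → ℝ)
    (ht : ∀ m : ℕ, (m : ℕ∞) < N → 0 ≤ t m ∧ 0 < δ m)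
    (hgap : ∀ m : ℕ, ((m + 1 : ℕ) : ℕ∞) < N → t m + δ m < t (m + 1))
    (hreach : ∀ s, Pursuit.Engaged T x s →
      (∀ m : ℕ, (m : ℕ∞) < N → s ∉ Set.Ico (t m) (t m + δ m)) →
      Pursuit.LeaderReachable V T (G s) (x s))
    (hδ : ∀ m : ℕ, (m : ℕ∞) < N → Pursuit.Engaged T x (t m) →
      ∀ i, δ m < Pursuit.estTime (V i) T (x (t m) i))
    (l : Fin n) (hl : Pursuit.IsLeader V T (x 0) l)
    (tf : ℝ) (htf : tf = Pursuit.estTime (V l) T (x 0 l)) :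
    0 < tf ∧
    (∃ tα ∈ Set.Ico 0 tf, ∀ s ∈ Set.Ico tα tf, ∀ i j,
      Pursuit.estTime (V i) T (x s i) = Pursuit.estTime (V j) T (x s j)) ∧
    (∀ i, ∀ s ∈ Set.Ico 0 tf, (x s i).pos ≠ T) ∧
    (∀ i, (x tf i).pos = T) := by
  have h0 : ∀ i, (Pursuit.relPos T (x 0 i)).im ≠ 0 := fun i =>
    Pursuit.im_relPos_ne_zero_of_leadAngle (hθ i)
  obtain ⟨tc, htc, htcf, heng, i₀, hi₀⟩ := hx.exists_first_interception hV h0 hl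
  have hlead : ∃ tα ∈ Ico 0 tc, ∀ s ∈ Ico tα tc, ∀ i,
      Pursuit.estTime (V i) T (x s i) + s = tf := by
    choose r hr hle using
      hx.exists_leader_time hV hG h0 ht hgap hreach hδ hl htc htcf heng hi₀
    -- After the latest of the attainment times, monotonicity and the upper bound `tf` pin every
    -- pursuer at `tf`.
    obtain ⟨k, -, hk⟩ := Finset.exists_max_image Finset.univ r ⟨l, Finset.mem_univ l⟩
    refine ⟨r k, hr k, fun s hs i => ?_⟩
    have hs0 : s ∈ Ico 0 tc := ⟨(hr k).1.trans hs.1, hs.2⟩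
    rw [htf]
    refine le_antisymm (hx.estTime_add_le_of_isLeader hV h0 hl (heng s hs0) i) ?_
    exact (hle i).trans (hx.estTime_add_le hV h0 (heng s hs0)
      ⟨(hr i).1, (hk i (Finset.mem_univ i)).trans hs.1⟩ i)
  obtain ⟨tα, htα, hall⟩ := hlead
  have hteq : tc = tf := by
    refine le_antisymm (htf ▸ htcf) ?_
    -- The intercepting pursuer has `z = tf` but also `z ≤ tc`.
    rw [← hall tα ⟨le_rfl, htα.2⟩ i₀]
    exact hx.estTime_add_le_of_interception hV h0 htc heng hi₀ htα
  subst hteq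
  refine ⟨htc, ⟨tα, htα, fun s hs i j => ?_⟩, fun i s hs => (heng s hs).2 s ⟨hs.1, le_rfl⟩ i,
    fun i => ?_⟩
  · linarith [hall s hs i, hall s hs j]
  · have h1 := hx.tendsto_norm_relPos htc i
    have h2 : Tendsto (fun s => V i * (tc - s)) (𝓝[<] tc) (𝓝 (V i * (tc - tc))) :=
      (Continuous.tendsto (by fun_prop) tc).mono_left nhdsWithin_le_nhds
    have h3 := le_of_tendsto_of_tendsto h1 h2 (by
      filter_upwards [Ioo_mem_nhdsLT htα.2] with s hs
      have hs0 : s ∈ Ico 0 tc := ⟨htα.1.trans hs.1.le, hs.2⟩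
      refine (Pursuit.norm_relPos_le_mul_estTime (hV i)
        (hx.im_ne_zero hV h0 (heng s hs0) i)).trans_eq ?_
      rw [← hall s ⟨hs.1.le, hs.2⟩ i, add_sub_cancel_right])
    rw [sub_self, mul_zero, norm_le_zero_iff, sub_eq_zero] at h3
    exact h3.symm
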